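/- **Setting.** Let $\Theta\subseteq\mathbb R$ be an open interval and let $p(y\mid\theta)=q(y)\exp(y\theta-b(\theta))$, $\theta\in\Theta$, be a one-parameter exponential family in canonical form ($q\ge 0$, each $p(\cdot\mid\theta)$ a probability density with respect to a fixed reference measure $\nu$ on $\mathbb R$), with $\ddot b>0$ on $\Theta$. For a sample $D=(y_1,\dots,y_n)$ write $L(\theta\mid D)=\prod_{i=1}^n p(y_i\mid\theta)$ and $\bar y=\frac1n\sum_i y_i$; similarly for the historical sample $D_0=(y_{01},\dots,y_{0n_0})$ with mean $\bar y_0$. Let $\pi_0\ge 0$ be an initial prior density for $\theta$ on $\Theta$ (possibly improper), let $\pi(a_0)$ be any probability density on $[0,1]$, let $c(a_0)=\int_\Theta L(\theta\mid D_0)^{a_0}\pi_0(\theta)\,d\theta$, and let the marginal posterior density of $a_0$ under the normalized power prior be $$\pi(a_0\mid D,D_0)=\frac{\int_\Theta L(\theta\mid D)\,\frac{L(\theta\mid D_0)^{a_0}\pi_0(\theta)}{c(a_0)}\,\pi(a_0)\,d\theta}{\int_0^1\int_\Theta L(\theta\mid D)\,\frac{L(\theta\mid D_0)^{t}\pi_0(\theta)}{c(t)}\,\pi(t)\,d\theta\,dt},\qquad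 a_0\in[0,1].$$ Let $r>0$ and let $\theta_0\in\Theta$ be a point at which $\pi_0$ is positive and continuous. **(1)** Consider samples $D$ and $D_0$ with values in $\{q>0\}$ of sizes $n\to\infty$ and $n_0$ (along a sequence) such that $n_0/n=r$ and $\bar y=\bar y_0$ throughout, $c(a_0)<\infty$ for all $a_0\in(0,1]$ from some index on, and the maximum likelihood estimates $\hat\theta_n\in\Theta$, $\dot b(\hat\theta_n)=\bar y$, exist from some index on and converge to $\theta_0$. Then, from some index on, $\pi(\cdot\mid D,D_0)$ is a well-defined probability density on $[0,1]$, and as $n\to\infty$ it converges, at every $a_0\in[0,1]$ and in $L^1([0,1])$, to the probability density $$\tilde\pi(a_0)=\frac{\sqrt{\frac{ra_0}{ra_0+1}}\;\pi(a_0)}{\int_0^1\sqrt{\frac{rt}{rt+1}}\;\pi(t)\,dt}.$$ (If $\int_\Theta\pi_0=\infty$, the density at the single point $a_0=0$, where $c(0)=\infty$, is read as $0$.) In particular the marginal posterior of $a_0$ does not converge to a point mass at one: it is not the case that $\int_{1-\varepsilon}^1\pi(a_0\mid D,D_0)\,da_0\to1$ for every $\varepsilon\in(0,1)$. **(2)**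 Let $Y_1,Y_2,\dots$ and $Y_{01},Y_{02},\dots$ be independent random variables, all with density $p(\cdot\mid\theta_0)$ with respect to $\nu$. Then, almost surely, the conclusions of (1) hold for $D=(Y_1,\dots,Y_n)$ and $D_0=(Y_{01},\dots,Y_{0n_0})$ along every sequence of sample sizes $n\to\infty$, $n_0=rn$, along which $\bar y=\bar y_0$ throughout and, from some index on, $c(a_0)<\infty$ for all $a_0\in(0,1]$. -/

import Mathlib

open MeasureTheory ProbabilityTheory Filter Topology Set

noncomputable section

namespace NPP

/-- The canonical one-parameter exponential-family density
`p(y | θ) = q(y) exp(y θ - b(θ))`. -/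
def density (q b : ℝ → ℝ) (θ y : ℝ) : ℝ :=
  q y * Real.exp (y * θ - b θ)

/-- `q`, `b` define a one-parameter exponential family with canonical parameter in the open
interval `Θ`: for each `θ ∈ Θ`, `p(· | θ)` is a probability density with respect to the reference
measure `ν` (for instance Lebesgue or counting measure). The values of `b` outside `Θ` are
irrelevant. -/
structure IsExpFamily (ν : Measure ℝ) (q b : ℝ → ℝ) (Θ : Set ℝ) : Prop where
  isOpen : IsOpen Θ
  ordConnected : Θ.OrdConnected
  measurable_q : Measurable q
  q_nonneg : ∀ y, 0 ≤ q y
  lintegral_eq_one : ∀ θ ∈ Θ, ∫⁻ y, ENNReal.ofReal (density q b θ y) ∂ν = 1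

/-- The likelihood `L(θ | D)` of a sample `D` of `n` i.i.d. observations. -/
def likelihood (q b : ℝ → ℝ) {n : ℕ} (D : Fin n → ℝ) (θ : ℝ) : ℝ :=
  ∏ i, density q b θ (D i)

/-- The sample mean. -/
def sampleMean {n : ℕ} (D : Fin n → ℝ) : ℝ :=
  (∑ i, D i) / n

/-- The integrand `L(θ | D₀)^a π₀(θ)` of the power prior. -/
def powerPriorKernel (q b π₀ : ℝ → ℝ) {m : ℕ} (D₀ : Fin m → ℝ) (a θ : ℝ) : ℝ :=
  likelihood q b D₀ θ ^ a * π₀ θ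

/-- The power prior with discounting parameter `a` is well defined for every `a ∈ (0, 1]`:
`c(a) < ∞`. -/
def PowerPriorProper (q b : ℝ → ℝ) (Θ : Set ℝ) (π₀ : ℝ → ℝ) {m : ℕ} (D₀ : Fin m → ℝ) : Prop :=
  ∀ a ∈ Ioc (0 : ℝ) 1, IntegrableOn (powerPriorKernel q b π₀ D₀ a) Θ

/-- The normalizing function `c(a) = ∫_Θ L(θ | D₀)^a π₀(θ) dθ`. -/
def normConst (q b : ℝ → ℝ) (Θ : Set ℝ) (π₀ : ℝ → ℝ) {m : ℕ} (D₀ : Fin m → ℝ) (a : ℝ) : ℝ :=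
  ∫ θ in Θ, powerPriorKernel q b π₀ D₀ a θ

/-- The normalized power prior `π(θ, a | D₀) = L(θ | D₀)^a π₀(θ) π(a) / c(a)`. -/
def normalizedPowerPrior (q b : ℝ → ℝ) (Θ : Set ℝ) (π₀ π : ℝ → ℝ) {m : ℕ} (D₀ : Fin m → ℝ)
    (θ a : ℝ) : ℝ :=
  powerPriorKernel q b π₀ D₀ a θ / normConst q b Θ π₀ D₀ a * π a

/-- The unnormalized marginal posterior of `a₀`: `∫_Θ L(θ | D) π(θ, a | D₀) dθ`. -/
def posteriorKernel (q b : ℝ → ℝ) (Θ : Set ℝ) (π₀ π : ℝ → ℝ) {n m : ℕ}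
    (D : Fin n → ℝ) (D₀ : Fin m → ℝ) (a : ℝ) : ℝ :=
  ∫ θ in Θ, likelihood q b D θ * normalizedPowerPrior q b Θ π₀ π D₀ θ a

/-- The marginal posterior density `π(a | D, D₀)` of `a₀ ∈ [0, 1]`. -/
def marginalPosterior (q b : ℝ → ℝ) (Θ : Set ℝ) (π₀ π : ℝ → ℝ) {n m : ℕ}
    (D : Fin n → ℝ) (D₀ : Fin m → ℝ) (a : ℝ) : ℝ :=
  posteriorKernel q b Θ π₀ π D D₀ a / ∫ t in Icc (0 : ℝ) 1, posteriorKernel q b Θ π₀ π D D₀ t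

/-- The limiting density, proportional to `√(r a / (r a + 1)) π(a)` on `[0, 1]`. -/
def limitDensity (r : ℝ) (π : ℝ → ℝ) (a : ℝ) : ℝ :=
  Real.sqrt (r * a / (r * a + 1)) * π a /
    ∫ t in Icc (0 : ℝ) 1, Real.sqrt (r * t / (r * t + 1)) * π t

/-- `p` is a probability density on `[0, 1]` with respect to Lebesgue measure. -/
def IsUnitDensity (p : ℝ → ℝ) : Prop :=
  (∀ a ∈ Icc (0 : ℝ) 1, 0 ≤ p a) ∧ IntegrableOn p (Icc 0 1) ∧ ∫ a in Icc (0 : ℝ) 1, p a = 1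

/-- The densities `p k` converge to the density `p'` on `[0, 1]`, both pointwise and in `L¹`
(i.e. the corresponding distributions converge in total variation); `p'` and all `p k` from some
`k` on are genuine probability densities. -/
def DensitiesConverge (p : ℕ → ℝ → ℝ) (p' : ℝ → ℝ) : Prop :=
  (∀ᶠ k in atTop, IsUnitDensity (p k)) ∧ IsUnitDensity p' ∧
  (∀ a ∈ Icc (0 : ℝ) 1, Tendsto (fun k => p k a) atTop (𝓝 (p' a))) ∧
  Tendsto (fun k => ∫ a in Icc (0 : ℝ) 1, |p k a - p' a|) atTop (𝓝 0)

/-- The distributions on `[0, 1]` with densities `p k` converge to the point mass at one. -/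
def ConcentratesAtOne (p : ℕ → ℝ → ℝ) : Prop :=
  ∀ ε ∈ Ioo (0 : ℝ) 1, Tendsto (fun k => ∫ a in Icc (1 - ε) 1, p k a) atTop (𝓝 1)

end NPP

end

/-! ### The exponential family: `b` as a cumulant function. -/

namespace NPP

/-! Since both samples have the same mean, one point `x` maximises both likelihoods, and each
likelihood equals its maximum times `exp(-n B(x, θ))`, where `B` is the Bregman divergence of `b`
and `n` the sample size. The maxima cancel on normalising, so the data act on the prior of `a` only
through the weight `∫ exp(-(n + a m) B) π₀ / ∫ exp(-a m B) π₀` (`posteriorKernel_eq`,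
`marginalPosterior_eq`).

Laplace's method (`tendsto_laplaceIntegral`) says that an integral of rate `s` behaves like `π₀(θ₀)
√(2π / b''(θ₀)) / √s`. The constant is common to numerator and denominator, so the weight tends to
`√(a m / (n + a m)) = √(r a / (r a + 1))`. Convexity of `b` gives `B ≥ 0`, hence weights at most
one, and dominated convergence with dominating function `π` yields convergence of the normalised
densities (`densitiesConverge_of_weights`). The limit has a density, hence no atom at one.

For i.i.d. samples, `b` is the cumulant function of the carrier measure, so the mean is `b'(θ₀)`.
The strong law and the inverse function theorem then produce maximum likelihood estimates converging
to `θ₀`. -/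

/-- The carrier measure `q dν` of the exponential family. -/
noncomputable def carrier (ν : Measure ℝ) (q : ℝ → ℝ) : Measure ℝ :=
  ν.withDensity fun y => ENNReal.ofReal (q y)

namespace IsExpFamily

variable {ν : Measure ℝ} {q b : ℝ → ℝ} {Θ : Set ℝ}

/-- This is the normalisation of `p(· | θ)` with the constant `exp(-b θ)` moved to the other side;
it identifies `b` with a log-Laplace transform. -/
lemma lintegral_exp_carrier (h : IsExpFamily ν q b Θ) {θ : ℝ} (hθ : θ ∈ Θ) :
    ∫⁻ y, ENNReal.ofReal (Real.exp (θ * y)) ∂(carrier ν q) = ENNReal.ofReal (Real.exp (b θ)) := by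
  have h1 := h.lintegral_eq_one θ hθ
  have hm : Measurable fun y => ENNReal.ofReal (Real.exp (θ * y)) := by fun_prop
  rw [carrier, lintegral_withDensity_eq_lintegral_mul _ h.measurable_q.ennreal_ofReal hm]
  have h2 : ∀ y, ((fun y => ENNReal.ofReal (q y)) * fun y => ENNReal.ofReal (Real.exp (θ * y))) y
      = ENNReal.ofReal (Real.exp (b θ)) * ENNReal.ofReal (density q b θ y) := by
    intro y
    rw [Pi.mul_apply, ← ENNReal.ofReal_mul (h.q_nonneg y), ← ENNReal.ofReal_mul (Real.exp_nonneg _),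
      density, mul_left_comm, ← Real.exp_add]
    congr 3
    ring
  simp_rw [h2]
  rw [lintegral_const_mul' _ _ ENNReal.ofReal_ne_top, h1, mul_one]

lemma integrable_exp_carrier (h : IsExpFamily ν q b Θ) {θ : ℝ} (hθ : θ ∈ Θ) :
    Integrable (fun y => Real.exp (θ * y)) (carrier ν q) := by
  refine ⟨by fun_prop, ?_⟩
  rw [hasFiniteIntegral_iff_ofReal (ae_of_all _ fun _ => (Real.exp_pos _).le),
    h.lintegral_exp_carrier hθ]
  exact ENNReal.ofReal_lt_top

lemma mgf_carrier (h : IsExpFamily ν q b Θ) {θ : ℝ} (hθ : θ ∈ Θ) :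
    mgf id (carrier ν q) θ = Real.exp (b θ) := by
  rw [mgf, integral_eq_lintegral_of_nonneg_ae (ae_of_all _ fun _ => (Real.exp_pos _).le)
    (by fun_prop)]
  simp only [id]
  rw [h.lintegral_exp_carrier hθ, ENNReal.toReal_ofReal (Real.exp_pos _).le]

/-- Openness of `Θ` is what makes analyticity and differentiation under the integral available at
every parameter. -/
lemma subset_interior (h : IsExpFamily ν q b Θ) :
    Θ ⊆ interior (integrableExpSet id (carrier ν q)) :=
  interior_maximal (fun _ hθ => h.integrable_exp_carrier hθ) h.isOpen

lemma eqOn_cgf (h : IsExpFamily ν q b Θ) : EqOn (cgf id (carrier ν q)) b Θ := fun θ hθ => by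
  rw [cgf, h.mgf_carrier hθ, Real.log_exp]

/-- The cumulant function of an exponential family is analytic. -/
lemma analyticOnNhd (h : IsExpFamily ν q b Θ) : AnalyticOnNhd ℝ b Θ :=
  (analyticOnNhd_cgf.mono h.subset_interior).congr h.isOpen h.eqOn_cgf

lemma deriv_eq (h : IsExpFamily ν q b Θ) {θ : ℝ} (hθ : θ ∈ Θ) :
    deriv b θ = (∫ y, y * Real.exp (θ * y) ∂(carrier ν q)) / Real.exp (b θ) := by
  rw [← h.mgf_carrier hθ]
  have := deriv_cgf (h.subset_interior hθ)
  rw [(h.eqOn_cgf.eventuallyEq_of_mem (h.isOpen.mem_nhds hθ)).deriv_eq] at this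
  simpa using this

lemma withDensity_density (h : IsExpFamily ν q b Θ) (θ : ℝ) :
    (ν.withDensity fun y => ENNReal.ofReal (density q b θ y)) =
      (carrier ν q).withDensity fun y => ENNReal.ofReal (Real.exp (θ * y - b θ)) := by
  rw [carrier, ← withDensity_mul _ h.measurable_q.ennreal_ofReal (by fun_prop)]
  congr 1
  ext y
  rw [Pi.mul_apply, ← ENNReal.ofReal_mul (h.q_nonneg y), density, mul_comm y θ]

lemma integrable_id (h : IsExpFamily ν q b Θ) {θ : ℝ} (hθ : θ ∈ Θ) :
    Integrable id (ν.withDensity fun y => ENNReal.ofReal (density q b θ y)) := by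
  rw [h.withDensity_density, integrable_withDensity_iff_integrable_smul' (by fun_prop)
    (ae_of_all _ fun _ => ENNReal.ofReal_lt_top)]
  have h1 := (integrable_pow_mul_exp_of_mem_interior_integrableExpSet
    (h.subset_interior hθ) 1).mul_const (Real.exp (- b θ))
  refine h1.congr (ae_of_all _ fun y => ?_)
  simp only [id, pow_one, smul_eq_mul]
  rw [ENNReal.toReal_ofReal (Real.exp_pos _).le, sub_eq_add_neg, Real.exp_add]
  ring

/-- The mean of the family at `θ` is the derivative of the cumulant function. -/
lemma integral_id (h : IsExpFamily ν q b Θ) {θ : ℝ} (hθ : θ ∈ Θ) :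
    ∫ y, y ∂(ν.withDensity fun y => ENNReal.ofReal (density q b θ y)) = deriv b θ := by
  rw [h.withDensity_density, integral_withDensity_eq_integral_toReal_smul (by fun_prop)
    (ae_of_all _ fun _ => ENNReal.ofReal_lt_top), h.deriv_eq hθ, ← integral_div]
  congr 1
  ext y
  rw [ENNReal.toReal_ofReal (Real.exp_pos _).le, Real.exp_sub, smul_eq_mul]
  ring

end IsExpFamily

end NPP

/-! ### Bregman divergence: convexity and growth. -/

namespace NPP

/-- The Bregman divergence of `b` between `x` and `y`. -/
noncomputable def bregman (b : ℝ → ℝ) (x y : ℝ) : ℝ := b y - b x - deriv b x * (y - x)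

section Bregman

variable {b : ℝ → ℝ} {Θ : Set ℝ}

lemma exists_bregman_eq (hc : Θ.OrdConnected) (hb : AnalyticOnNhd ℝ b Θ)
    {x y : ℝ} (hx : x ∈ Θ) (hy : y ∈ Θ) :
    ∃ ξ ∈ uIcc x y, bregman b x y = deriv (deriv b) ξ * (y - x) ^ 2 / 2 := by
  rcases eq_or_ne x y with rfl | hne
  · exact ⟨x, left_mem_uIcc, by simp [bregman]⟩
  have hsub : uIcc x y ⊆ Θ := hc.uIcc_subset hx hy
  obtain ⟨ξ, hξ, h⟩ := taylor_mean_remainder_lagrange_iteratedDeriv (n := 1) hne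
    ((hb.mono hsub).contDiffOn (uniqueDiffOn_uIcc hne))
  refine ⟨ξ, Ioo_subset_Icc_self hξ, ?_⟩
  have hd : derivWithin b (uIcc x y) x = deriv b x :=
    (hb x hx).differentiableAt.derivWithin ((uniqueDiffOn_uIcc hne) x left_mem_uIcc)
  rw [taylorWithinEval_succ, taylor_within_zero_eval, iteratedDerivWithin_one, hd] at h
  simp only [iteratedDeriv_succ, iteratedDeriv_zero] at h
  rw [bregman]
  norm_num at h
  linarith

lemma bregman_nonneg (hc : Θ.OrdConnected) (hb : AnalyticOnNhd ℝ b Θ)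
    (hpos : ∀ θ ∈ Θ, 0 < deriv (deriv b) θ) {x y : ℝ} (hx : x ∈ Θ) (hy : y ∈ Θ) :
    0 ≤ bregman b x y := by
  obtain ⟨ξ, hξ, h⟩ := exists_bregman_eq hc hb hx hy
  have := hpos ξ (hc.uIcc_subset hx hy hξ)
  rw [h]
  positivity

lemma le_bregman {S : Set ℝ} (hS : S.OrdConnected) (hb : AnalyticOnNhd ℝ b S) {m : ℝ}
    (hm : ∀ ξ ∈ S, m ≤ deriv (deriv b) ξ) {x y : ℝ} (hx : x ∈ S) (hy : y ∈ S) :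
    m / 2 * (y - x) ^ 2 ≤ bregman b x y := by
  obtain ⟨ξ, hξ, h⟩ := exists_bregman_eq hS hb hx hy
  have := mul_le_mul_of_nonneg_right (hm ξ (hS.uIcc_subset hx hy hξ)) (sq_nonneg (y - x))
  linarith

/-- Average the tangent-line inequalities at `z` towards `x` and `y` with weights `1 - t` and `t`;
the first-order terms cancel. -/
lemma convexOn_bregman (hc : Θ.OrdConnected) (hb : AnalyticOnNhd ℝ b Θ)
    (hpos : ∀ θ ∈ Θ, 0 < deriv (deriv b) θ) {x y z t : ℝ} (hx : x ∈ Θ) (hy : y ∈ Θ)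
    (ht0 : 0 ≤ t) (ht1 : t ≤ 1) (hz : z = x + t * (y - x)) :
    bregman b x z ≤ t * bregman b x y := by
  have hzΘ : z ∈ Θ := by
    have h := hc.convex.add_smul_sub_mem hx hy ⟨ht0, ht1⟩
    rwa [smul_eq_mul, ← hz] at h
  have h1 := bregman_nonneg hc hb hpos hzΘ hx
  have h2 := bregman_nonneg hc hb hpos hzΘ hy
  have h3 := mul_le_mul_of_nonneg_left h2 ht0
  have h4 := mul_le_mul_of_nonneg_left h1 (sub_nonneg.2 ht1)
  unfold bregman at *
  have : deriv b z * ((1 - t) * (x - z) + t * (y - z)) = 0 := by rw [hz]; ring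
  rw [hz] at *
  nlinarith

/-- Away from its minimum the divergence grows at least linearly. -/
lemma linear_le_bregman (hc : Θ.OrdConnected) (hb : AnalyticOnNhd ℝ b Θ)
    (hpos : ∀ θ ∈ Θ, 0 < deriv (deriv b) θ) {x y δ m : ℝ} (hx : x ∈ Θ) (hy : y ∈ Θ) (hδ : 0 < δ)
    (hball : Metric.closedBall x δ ⊆ Θ)
    (hm : ∀ ξ ∈ Metric.closedBall x δ, m ≤ deriv (deriv b) ξ)
    (hxy : δ ≤ |y - x|) : m * δ / 2 * |y - x| ≤ bregman b x y := by
  have hpos' : 0 < |y - x| := hδ.trans_le hxy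
  -- With this `t` the point `x + t (y - x)` lies at distance exactly `δ` from `x`: the quadratic
  -- bound applies there, and convexity along the segment carries it out to `y`.
  set t := δ / |y - x| with ht
  have ht1 : t ≤ 1 := (div_le_one hpos').2 hxy
  have h1 := convexOn_bregman hc hb hpos hx hy (by positivity) ht1 rfl
  have hz : x + t * (y - x) ∈ Metric.closedBall x δ := by
    rw [Metric.mem_closedBall, Real.dist_eq, add_sub_cancel_left, abs_mul, abs_of_nonneg (by positivity), ht,
      div_mul_cancel₀ _ hpos'.ne']
  have h2 := le_bregman (S := Metric.closedBall x δ) ((convex_closedBall x δ).ordConnected) (hb.mono hball) hm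
    (Metric.mem_closedBall_self hδ.le) hz
  have h3 : (x + t * (y - x) - x) ^ 2 = δ ^ 2 := by
    rw [add_sub_cancel_left, mul_pow, ← sq_abs (y - x), ht, div_pow, div_mul_cancel₀ _ (by positivity)]
  rw [h3] at h2
  have h4 : m / 2 * δ ^ 2 ≤ t * bregman b x y := h2.trans h1
  have h5 : t * |y - x| = δ := div_mul_cancel₀ _ hpos'.ne'
  have h6 := mul_le_mul_of_nonneg_right h4 (div_nonneg hpos'.le hδ.le)
  calc _ = m / 2 * δ ^ 2 * (|y - x| / δ) := by field_simp
    _ ≤ _ := h6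
    _ = (t * |y - x|) * bregman b x y / δ := by ring
    _ = _ := by rw [h5]; field_simp

/-- Moving the base point of the divergence slightly changes it little, relative to the distance
from the base point. -/
lemma eventually_abs_bregman_sub_le {x₀ : ℝ} (hb : AnalyticAt ℝ b x₀) {x : ℕ → ℝ}
    (hx : Tendsto x atTop (𝓝 x₀)) {δ ε : ℝ} (hδ : 0 < δ) (hε : 0 < ε) :
    ∀ᶠ k in atTop, ∀ y, δ ≤ |y - x₀| → |bregman b (x k) y - bregman b x₀ y| ≤ ε * |y - x₀| := by
  have hbx : Tendsto (fun k => b (x k)) atTop (𝓝 (b x₀)) := hb.continuousAt.tendsto.comp hx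
  have hdx : Tendsto (fun k => deriv b (x k)) atTop (𝓝 (deriv b x₀)) :=
    hb.deriv.continuousAt.tendsto.comp hx
  have hA : Tendsto (fun k => |b x₀ - b (x k) - deriv b (x k) * (x₀ - x k)|) atTop (𝓝 0) := by
    have := ((tendsto_const_nhds (x := b x₀)).sub hbx).sub
      (hdx.mul ((tendsto_const_nhds (x := x₀)).sub hx))
    simpa using this.abs
  have hB : Tendsto (fun k => |deriv b (x k) - deriv b x₀|) atTop (𝓝 0) := by
    simpa using (hdx.sub_const (deriv b x₀)).abs
  filter_upwards [hA.eventually_le_const (show 0 < ε * δ / 2 by positivity),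
    hB.eventually_le_const (show 0 < ε / 2 by positivity)] with k h1 h2 y hy
  -- The term `b y` cancels, so the difference is affine in `y`; its constant part is absorbed using
  -- `δ ≤ |y - x₀|`.
  have h3 : bregman b (x k) y - bregman b x₀ y =
      (b x₀ - b (x k) - deriv b (x k) * (x₀ - x k)) - (deriv b (x k) - deriv b x₀) * (y - x₀) := by
    unfold bregman; ring
  rw [h3]
  refine (abs_sub _ _).trans ?_
  rw [abs_mul]
  have h4 := mul_le_mul_of_nonneg_right h2 (abs_nonneg (y - x₀))
  have h5 := mul_le_mul_of_nonneg_left hy (half_pos hε).le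
  linarith

/-- The second-order behaviour of the divergence along moving points. -/
lemma tendsto_bregman_scaled (ho : IsOpen Θ) (hc : Θ.OrdConnected) (hb : AnalyticOnNhd ℝ b Θ)
    {x₀ : ℝ} (hx₀ : x₀ ∈ Θ) {x s : ℕ → ℝ} (hx : Tendsto x atTop (𝓝 x₀))
    (hs : Tendsto s atTop atTop) (u : ℝ) :
    Tendsto (fun k => s k * bregman b (x k) (x k + (√(s k))⁻¹ * u)) atTop
      (𝓝 (deriv (deriv b) x₀ / 2 * u ^ 2)) := by
  have hy : Tendsto (fun k => x k + (√(s k))⁻¹ * u) atTop (𝓝 x₀) := by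
    have h0 : Tendsto (fun k => (√(s k))⁻¹) atTop (𝓝 0) :=
      tendsto_inv_atTop_zero.comp (Real.tendsto_sqrt_atTop.comp hs)
    simpa using hx.add (h0.mul_const u)
  have hex : ∀ᶠ k in atTop, ∃ ξ ∈ uIcc (x k) (x k + (√(s k))⁻¹ * u),
      bregman b (x k) (x k + (√(s k))⁻¹ * u) =
        deriv (deriv b) ξ * (x k + (√(s k))⁻¹ * u - x k) ^ 2 / 2 := by
    filter_upwards [hx.eventually_mem (ho.mem_nhds hx₀), hy.eventually_mem (ho.mem_nhds hx₀)]
      with k h1 h2 using exists_bregman_eq hc hb h1 h2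
  obtain ⟨ξ, hξ⟩ := hex.choice
  have hξ₀ : Tendsto ξ atTop (𝓝 x₀) := by
    have h1 : Tendsto (fun k => min (x k) (x k + (√(s k))⁻¹ * u)) atTop (𝓝 x₀) := by
      simpa using hx.min hy
    have h2 : Tendsto (fun k => max (x k) (x k + (√(s k))⁻¹ * u)) atTop (𝓝 x₀) := by
      simpa using hx.max hy
    exact tendsto_of_tendsto_of_tendsto_of_le_of_le' h1 h2 (hξ.mono fun k hk => hk.1.1)
      (hξ.mono fun k hk => hk.1.2)
  have hlim := ((hb x₀ hx₀).deriv.deriv.continuousAt.tendsto.comp hξ₀).div_const 2 |>.mul_const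
    (u ^ 2)
  refine hlim.congr' ?_
  filter_upwards [hξ, hs.eventually_gt_atTop 0] with k hk hsk
  rw [hk.2, add_sub_cancel_left, mul_pow, inv_pow, Real.sq_sqrt hsk.le, Function.comp_apply]
  field_simp

end Bregman

end NPP

/-! ### Laplace's method with moving modes. -/

namespace NPP

/-- The integral `∫_Θ exp(-s B(x, θ)) w(θ) dθ` for the Bregman divergence `B` of `b`. -/
noncomputable def laplaceIntegral (b : ℝ → ℝ) (Θ : Set ℝ) (w : ℝ → ℝ) (x s : ℝ) : ℝ :=
  ∫ θ in Θ, Real.exp (-(s * bregman b x θ)) * w θ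

section Laplace

variable {b w : ℝ → ℝ} {Θ : Set ℝ} {x₀ : ℝ}

lemma continuousOn_bregman (hb : AnalyticOnNhd ℝ b Θ) (x : ℝ) : ContinuousOn (bregman b x) Θ := by
  have := hb.continuousOn
  unfold bregman
  fun_prop

lemma aestronglyMeasurable_kernel (ho : IsOpen Θ) (hb : AnalyticOnNhd ℝ b Θ)
    (hw : AEStronglyMeasurable w (volume.restrict Θ)) (x s : ℝ) :
    AEStronglyMeasurable (fun θ => Real.exp (-(s * bregman b x θ)) * w θ)
      (volume.restrict Θ) := by
  refine AEStronglyMeasurable.mul ?_ hw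
  have := continuousOn_bregman hb x
  exact ContinuousOn.aestronglyMeasurable (by fun_prop) ho.measurableSet

lemma exists_local_bounds (ho : IsOpen Θ) (hb : AnalyticOnNhd ℝ b Θ) (hx₀ : x₀ ∈ Θ)
    (hpos : 0 < deriv (deriv b) x₀) (hwc : ContinuousAt w x₀) :
    ∃ δ > 0, ∃ m > 0, ∃ C, Metric.closedBall x₀ δ ⊆ Θ ∧
      (∀ ξ ∈ Metric.closedBall x₀ δ, m ≤ deriv (deriv b) ξ) ∧
      ∀ ξ ∈ Metric.closedBall x₀ δ, |w ξ| ≤ C := by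
  have h1 : ∀ᶠ ξ in 𝓝 x₀, deriv (deriv b) x₀ / 2 < deriv (deriv b) ξ :=
    (hb x₀ hx₀).deriv.deriv.continuousAt.eventually_const_lt (half_lt_self hpos)
  have h2 : ∀ᶠ ξ in 𝓝 x₀, |w ξ| < |w x₀| + 1 :=
    hwc.abs.eventually_lt_const (lt_add_one _)
  obtain ⟨δ, hδ, h⟩ := Metric.nhds_basis_closedBall.eventually_iff.1
    ((ho.eventually_mem hx₀).and (h1.and h2))
  exact ⟨δ, hδ, _, half_pos hpos, _, fun ξ hξ => (h hξ).1, fun ξ hξ => (h hξ).2.1.le,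
    fun ξ hξ => (h hξ).2.2.le⟩

lemma integrableOn_ball_kernel (ho : IsOpen Θ) (hc : Θ.OrdConnected) (hb : AnalyticOnNhd ℝ b Θ)
    (hpos : ∀ θ ∈ Θ, 0 < deriv (deriv b) θ)
    (hw : AEStronglyMeasurable w (volume.restrict Θ)) {δ C : ℝ}
    (hball : Metric.closedBall x₀ δ ⊆ Θ) (hC : ∀ ξ ∈ Metric.closedBall x₀ δ, |w ξ| ≤ C)
    {x s : ℝ} (hx : x ∈ Θ) (hs : 0 ≤ s) :
    IntegrableOn (fun θ => Real.exp (-(s * bregman b x θ)) * w θ) (Metric.ball x₀ δ) := by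
  refine ⟨(aestronglyMeasurable_kernel ho hb hw x s).mono_measure (Measure.restrict_mono
    (Metric.ball_subset_closedBall.trans hball) le_rfl),
    .restrict_of_bounded (C := C) measure_ball_lt_top ?_⟩
  filter_upwards [ae_restrict_mem measurableSet_ball] with θ hθ
  have hθ' := Metric.ball_subset_closedBall hθ
  rw [norm_mul, Real.norm_eq_abs, Real.abs_exp, Real.norm_eq_abs]
  have h1 : Real.exp (-(s * bregman b x θ)) ≤ 1 := Real.exp_le_one_iff.2
    (neg_nonpos.2 (mul_nonneg hs (bregman_nonneg hc hb hpos hx (hball hθ'))))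
  exact (mul_le_of_le_one_left (abs_nonneg _) h1).trans (hC θ hθ')

/-- The contribution of a neighbourhood of the mode to Laplace's approximation. -/
lemma tendsto_laplace_local (ho : IsOpen Θ) (hc : Θ.OrdConnected) (hb : AnalyticOnNhd ℝ b Θ)
    (hpos : ∀ θ ∈ Θ, 0 < deriv (deriv b) θ) (hx₀ : x₀ ∈ Θ)
    (hw : AEStronglyMeasurable w (volume.restrict Θ)) (hwc : ContinuousAt w x₀) {δ m C : ℝ}
    (hδ : 0 < δ) (hm0 : 0 < m)
    (hball : Metric.closedBall x₀ δ ⊆ Θ)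
    (hm : ∀ ξ ∈ Metric.closedBall x₀ δ, m ≤ deriv (deriv b) ξ)
    (hC : ∀ ξ ∈ Metric.closedBall x₀ δ, |w ξ| ≤ C)
    {x s : ℕ → ℝ} (hx : Tendsto x atTop (𝓝 x₀)) (hs : Tendsto s atTop atTop) :
    Tendsto (fun k => √(s k) * ∫ θ in Metric.ball x₀ δ,
      Real.exp (-(s k * bregman b (x k) θ)) * w θ) atTop
      (𝓝 (w x₀ * √(2 * Real.pi / deriv (deriv b) x₀))) := by
  -- Extending the integrand by zero lets the substitution `θ = x k + u / √(s k)` be made over the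
  -- whole line, with no moving domain.
  set f : ℕ → ℝ → ℝ := fun k => (Metric.ball x₀ δ).indicator
    fun θ => Real.exp (-(s k * bregman b (x k) θ)) * w θ with hf
  have hxball : ∀ᶠ k in atTop, x k ∈ Metric.ball x₀ δ :=
    hx.eventually_mem (Metric.ball_mem_nhds x₀ hδ)
  have hC0 : 0 ≤ C := (abs_nonneg _).trans (hC x₀ (Metric.mem_closedBall_self hδ.le))
  have hfint : ∀ᶠ k in atTop, Integrable (f k) := by
    filter_upwards [hxball, hs.eventually_ge_atTop 0] with k h1 h2
    exact (integrableOn_ball_kernel ho hc hb hpos hw hball hC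
      (hball (Metric.ball_subset_closedBall h1)) h2).integrable_indicator measurableSet_ball
  have hscale : ∀ᶠ k in atTop, ∫ u, f k (x k + (√(s k))⁻¹ * u) =
      √(s k) * ∫ θ in Metric.ball x₀ δ, Real.exp (-(s k * bregman b (x k) θ)) * w θ := by
    filter_upwards with k
    rw [Measure.integral_comp_mul_left (fun v => f k (x k + v)), inv_inv,
      abs_of_nonneg (Real.sqrt_nonneg _), integral_add_left_eq_self, hf,
      integral_indicator measurableSet_ball, smul_eq_mul]
  have hlim : ∫ u, Real.exp (-(deriv (deriv b) x₀ / 2 * u ^ 2)) * w x₀ =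
      w x₀ * √(2 * Real.pi / deriv (deriv b) x₀) := by
    rw [integral_mul_const, mul_comm]
    simp_rw [← neg_mul]
    rw [integral_gaussian]
    congr 2
    field_simp
  rw [← hlim]
  refine Tendsto.congr' hscale (tendsto_integral_filter_of_dominated_convergence
    (fun u => C * Real.exp (-(m / 2) * u ^ 2)) ?_ ?_
    ((integrable_exp_neg_mul_sq (half_pos hm0)).const_mul C) (ae_of_all _ fun u => ?_))
  · filter_upwards [hfint, hs.eventually_gt_atTop 0] with k h1 h2
    exact ((h1.comp_add_left (x k)).comp_mul_left'
      (inv_ne_zero (Real.sqrt_pos.2 h2).ne')).aestronglyMeasurable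
  · filter_upwards [hxball, hs.eventually_gt_atTop 0] with k h1 h2
    refine ae_of_all _ fun u => ?_
    by_cases hu : x k + (√(s k))⁻¹ * u ∈ Metric.ball x₀ δ
    · simp only [hf, indicator_of_mem hu]
      rw [norm_mul, Real.norm_eq_abs, Real.abs_exp, Real.norm_eq_abs, mul_comm]
      refine mul_le_mul (hC _ (Metric.ball_subset_closedBall hu)) (Real.exp_le_exp.2 ?_)
        (Real.exp_pos _).le hC0
      -- Strong convexity on the ball, based at the moving mode, gives a Gaussian bound in `u`
      -- independent of `k`.
      have h3 := le_bregman (convex_closedBall x₀ δ).ordConnected (hb.mono hball) hm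
        (Metric.ball_subset_closedBall h1) (Metric.ball_subset_closedBall hu)
      have h4 := mul_le_mul_of_nonneg_left h3 h2.le
      rw [add_sub_cancel_left, mul_pow, inv_pow, Real.sq_sqrt h2.le] at h4
      have h5 : s k * (m / 2 * ((s k)⁻¹ * u ^ 2)) = m / 2 * u ^ 2 := by field_simp
      linarith
    · simp only [hf, indicator_of_notMem hu, norm_zero]
      positivity
  · have hy : Tendsto (fun k => x k + (√(s k))⁻¹ * u) atTop (𝓝 x₀) := by
      have h0 : Tendsto (fun k => (√(s k))⁻¹) atTop (𝓝 0) :=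
        tendsto_inv_atTop_zero.comp (Real.tendsto_sqrt_atTop.comp hs)
      simpa using hx.add (h0.mul_const u)
    have h1 := ((Real.continuous_exp.tendsto _).comp
      (tendsto_bregman_scaled ho hc hb hx₀ hx hs u).neg).mul (hwc.tendsto.comp hy)
    refine h1.congr' ?_
    filter_upwards [hy.eventually_mem (Metric.ball_mem_nhds x₀ hδ)] with k hk
    simp only [hf, indicator_of_mem hk, Function.comp_apply]

/-- The contribution of the complement of a neighbourhood of the mode. -/
lemma laplace_tail (ho : IsOpen Θ) (hc : Θ.OrdConnected) (hb : AnalyticOnNhd ℝ b Θ)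
    (hpos : ∀ θ ∈ Θ, 0 < deriv (deriv b) θ) (hx₀ : x₀ ∈ Θ) {δ m : ℝ}
    (hδ : 0 < δ) (hm0 : 0 < m)
    (hball : Metric.closedBall x₀ δ ⊆ Θ)
    (hm : ∀ ξ ∈ Metric.closedBall x₀ δ, m ≤ deriv (deriv b) ξ)
    {x s : ℕ → ℝ} (hx : Tendsto x atTop (𝓝 x₀)) (hs : Tendsto s atTop atTop)
    (hint : ∀ᶠ k in atTop, ∃ t, 0 ≤ t ∧
      IntegrableOn (fun θ => Real.exp (-(t * bregman b (x k) θ)) * w θ) Θ)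
    (hw : AEStronglyMeasurable w (volume.restrict Θ)) :
    (∀ᶠ k in atTop, IntegrableOn (fun θ => Real.exp (-(s k * bregman b (x k) θ)) * w θ)
        (Θ \ Metric.ball x₀ δ)) ∧
      Tendsto (fun k => √(s k) * ∫ θ in Θ \ Metric.ball x₀ δ,
        Real.exp (-(s k * bregman b (x k) θ)) * w θ) atTop (𝓝 0) := by
  set A := Θ \ Metric.ball x₀ δ with hA
  have hAm : MeasurableSet A := ho.measurableSet.diff measurableSet_ball
  have hmeas : ∀ y t, AEStronglyMeasurable (fun θ => Real.exp (-(t * bregman b y θ)) * w θ)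
      (volume.restrict A) := fun y t =>
    (aestronglyMeasurable_kernel ho hb hw y t).mono_measure (Measure.restrict_mono sdiff_subset le_rfl)
  have hfar : ∀ θ ∈ A, δ ≤ |θ - x₀| := fun θ hθ => by
    have := hθ.2
    rwa [Metric.mem_ball, Real.dist_eq, not_lt] at this
  have hlin : ∀ θ ∈ A, m * δ / 2 * |θ - x₀| ≤ bregman b x₀ θ := fun θ hθ =>
    linear_le_bregman hc hb hpos hx₀ hθ.1 hδ hball hm (hfar θ hθ)
  -- This value makes the error of moving the base point at most half of the linear lower bound `m δ
  -- / 2 * |θ - x₀|`.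
  set c := m * δ / 4 with hcdef
  have hc0 : 0 < c := by positivity
  have hcmp : ∀ᶠ k in atTop, ∀ θ ∈ A, bregman b x₀ θ / 2 ≤ bregman b (x k) θ ∧
      bregman b (x k) θ ≤ 2 * bregman b x₀ θ := by
    filter_upwards [eventually_abs_bregman_sub_le (hb x₀ hx₀) hx hδ hc0] with k hk θ hθ
    have h1 := abs_le.1 (hk θ (hfar θ hθ))
    have h2 := hlin θ hθ
    have h3 : c * |θ - x₀| ≤ bregman b x₀ θ / 2 := by rw [hcdef]; linarith
    have h4 := bregman_nonneg hc hb hpos hx₀ hθ.1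
    constructor <;> linarith
  -- Since `w` need not be integrable, one index with an integrable kernel supplies the dominating
  -- function `g`; passing from base `x k₁` to `x₀` costs the factor 2 in its rate.
  obtain ⟨k₁, ⟨t, ht, hti⟩, hk₁⟩ := (hint.and hcmp).exists
  set g : ℝ → ℝ := fun θ => Real.exp (-(2 * t * bregman b x₀ θ)) * w θ with hg
  have hgint : IntegrableOn g A := by
    refine Integrable.mono (hti.mono_set sdiff_subset) (hmeas x₀ (2 * t)) ?_
    filter_upwards [ae_restrict_mem hAm] with θ hθ
    rw [norm_mul, norm_mul]
    refine mul_le_mul_of_nonneg_right ?_ (norm_nonneg _)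
    rw [Real.norm_eq_abs, Real.abs_exp, Real.norm_eq_abs, Real.abs_exp, Real.exp_le_exp]
    have := mul_le_mul_of_nonneg_left (hk₁ θ hθ).2 ht
    linarith
  -- Off the ball the divergence from `x₀` is at least `m δ² / 2 = 2κ`. Splitting the rate `s k / 2`
  -- into `2t`, which keeps `g`, and the remainder leaves the factor `exp(4tκ - κ s k)`.
  set κ := m * δ ^ 2 / 4 with hκ
  have hκ0 : 0 < κ := by positivity
  have hbound : ∀ᶠ k in atTop, ∀ θ ∈ A, ‖Real.exp (-(s k * bregman b (x k) θ)) * w θ‖ ≤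
      Real.exp (4 * t * κ) * Real.exp (-(κ * s k)) * ‖g θ‖ := by
    filter_upwards [hcmp, hs.eventually_ge_atTop (4 * t), hs.eventually_ge_atTop 0]
      with k h1 h2 h3 θ hθ
    rw [hg, norm_mul, norm_mul, ← mul_assoc]
    refine mul_le_mul_of_nonneg_right ?_ (norm_nonneg _)
    rw [Real.norm_eq_abs, Real.abs_exp, Real.norm_eq_abs, Real.abs_exp, ← Real.exp_add,
      ← Real.exp_add, Real.exp_le_exp]
    have h4 := mul_le_mul_of_nonneg_left (h1 θ hθ).1 h3
    have h5 : 2 * κ ≤ bregman b x₀ θ := by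
      refine le_trans ?_ (hlin θ hθ)
      have := mul_le_mul_of_nonneg_left (hfar θ hθ) (show 0 ≤ m * δ / 2 by positivity)
      rw [hκ]; linarith
    have h6 := mul_le_mul_of_nonneg_left h5 (show 0 ≤ s k / 2 - 2 * t by linarith)
    linarith
  refine ⟨?_, ?_⟩
  · filter_upwards [hbound] with k hk
    refine (hgint.norm.const_mul (Real.exp (4 * t * κ) * Real.exp (-(κ * s k)))).mono'
      (hmeas _ _) ?_
    filter_upwards [ae_restrict_mem hAm] with θ hθ using hk θ hθ
  · have hlim : Tendsto (fun k => √(s k) * Real.exp (-(κ * s k)) *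
        (Real.exp (4 * t * κ) * ∫ θ in A, ‖g θ‖)) atTop (𝓝 0) := by
      have h1 : Tendsto (fun y : ℝ => y ^ (1 / 2 : ℝ) * Real.exp (-κ * y)) atTop (𝓝 0) :=
        tendsto_rpow_mul_exp_neg_mul_atTop_nhds_zero _ κ hκ0
      have h2 := (h1.comp hs).mul_const (Real.exp (4 * t * κ) * ∫ θ in A, ‖g θ‖)
      rw [zero_mul] at h2
      refine h2.congr fun k => ?_
      rw [Function.comp_apply, Real.sqrt_eq_rpow, neg_mul]
    refine squeeze_zero_norm' ?_ hlim
    filter_upwards [hbound] with k hk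
    rw [norm_mul, Real.norm_of_nonneg (Real.sqrt_nonneg _), mul_assoc]
    refine mul_le_mul_of_nonneg_left ?_ (Real.sqrt_nonneg _)
    refine (norm_integral_le_of_norm_le (hgint.norm.const_mul
      (Real.exp (4 * t * κ) * Real.exp (-(κ * s k)))) ?_).trans (le_of_eq ?_)
    · filter_upwards [ae_restrict_mem hAm] with θ hθ using hk θ hθ
    · rw [integral_const_mul]; ring

/-- **Laplace's approximation** along moving modes `x k → x₀` and rates `s k → ∞`. -/
theorem tendsto_laplaceIntegral (ho : IsOpen Θ) (hc : Θ.OrdConnected) (hb : AnalyticOnNhd ℝ b Θ)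
    (hpos : ∀ θ ∈ Θ, 0 < deriv (deriv b) θ) (hx₀ : x₀ ∈ Θ) (hwc : ContinuousAt w x₀)
    {x s : ℕ → ℝ} (hx : Tendsto x atTop (𝓝 x₀)) (hs : Tendsto s atTop atTop)
    (hint : ∀ᶠ k in atTop, ∃ t, 0 ≤ t ∧
      IntegrableOn (fun θ => Real.exp (-(t * bregman b (x k) θ)) * w θ) Θ)
    (hw : AEStronglyMeasurable w (volume.restrict Θ)) :
    Tendsto (fun k => √(s k) * laplaceIntegral b Θ w (x k) (s k)) atTop
      (𝓝 (w x₀ * √(2 * Real.pi / deriv (deriv b) x₀))) := by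
  obtain ⟨δ, hδ, m, hm0, C, hball, hm, hC⟩ := exists_local_bounds ho hb hx₀ (hpos x₀ hx₀) hwc
  have h1 := tendsto_laplace_local ho hc hb hpos hx₀ hw hwc hδ hm0 hball hm hC hx hs
  obtain ⟨h2, h3⟩ := laplace_tail ho hc hb hpos hx₀ hδ hm0 hball hm hx hs hint hw
  have h4 := h1.add h3
  rw [add_zero] at h4
  refine h4.congr' ?_
  filter_upwards [h2, hx.eventually_mem (ho.mem_nhds hx₀), hs.eventually_ge_atTop 0]
    with k hk hxk hsk
  have hbΘ : Metric.ball x₀ δ ⊆ Θ := Metric.ball_subset_closedBall.trans hball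
  rw [laplaceIntegral, ← mul_add, ← setIntegral_union disjoint_sdiff_self_right
    (ho.measurableSet.diff measurableSet_ball)
    (integrableOn_ball_kernel ho hc hb hpos hw hball hC hxk hsk) hk, union_sdiff_cancel hbΘ]

end Laplace

end NPP

/-! ### Convergence of reweighted densities. -/

namespace NPP

section Reweighting

variable {π H : ℝ → ℝ} {h p : ℕ → ℝ → ℝ} {p' : ℝ → ℝ}

/-- If the integral vanished, positivity of `H` off the null point `0` would force `π = 0` almost
everywhere, against total mass one. -/
lemma integral_reweight_pos (hπ : IsUnitDensity π) (hHpos : ∀ a ∈ Ioc (0 : ℝ) 1, 0 < H a)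
    (hint : IntegrableOn (fun a => H a * π a) (Icc 0 1)) :
    0 < ∫ a in Icc (0 : ℝ) 1, H a * π a := by
  have hint' := hint.mono_set Ioc_subset_Icc_self
  rw [integral_Icc_eq_integral_Ioc]
  have hnn : 0 ≤ᵐ[volume.restrict (Ioc (0 : ℝ) 1)] fun a => H a * π a := by
    filter_upwards [ae_restrict_mem measurableSet_Ioc] with a ha
    exact mul_nonneg (hHpos a ha).le (hπ.1 a (Ioc_subset_Icc_self ha))
  refine lt_of_le_of_ne (integral_nonneg_of_ae hnn) fun h0 => ?_
  have h1 := (integral_eq_zero_iff_of_nonneg_ae hnn hint').1 h0.symm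
  have h2 : π =ᵐ[volume.restrict (Ioc (0 : ℝ) 1)] 0 := by
    filter_upwards [h1, ae_restrict_mem measurableSet_Ioc] with a ha hm
    exact (mul_eq_zero.1 ha).resolve_left (hHpos a hm).ne'
  have h3 := hπ.2.2
  rw [integral_Icc_eq_integral_Ioc, integral_congr_ae h2] at h3
  simp at h3

/-- Densities obtained from a fixed density by reweighting with converging bounded weights
converge. -/
lemma densitiesConverge_of_weights (hπ : IsUnitDensity π)
    (hHpos : ∀ a ∈ Ioc (0 : ℝ) 1, 0 < H a)
    (hlim : ∀ a ∈ Icc (0 : ℝ) 1, Tendsto (fun k => h k a) atTop (𝓝 (H a)))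
    (hnn : ∀ᶠ k in atTop, ∀ a ∈ Icc (0 : ℝ) 1, 0 ≤ h k a)
    (hle : ∀ᶠ k in atTop, ∀ a ∈ Ioc (0 : ℝ) 1, h k a ≤ 1)
    (hmeas : ∀ᶠ k in atTop, AEMeasurable (h k) (volume.restrict (Ioc 0 1)))
    (hp : ∀ᶠ k in atTop, ∀ a, p k a = h k a * π a / ∫ t in Icc (0 : ℝ) 1, h k t * π t)
    (hp' : ∀ a, p' a = H a * π a / ∫ t in Icc (0 : ℝ) 1, H t * π t) :
    DensitiesConverge p p' := by
  have hμ : volume.restrict (Ioc (0 : ℝ) 1) = volume.restrict (Icc (0 : ℝ) 1) :=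
    Measure.restrict_congr_set Ioc_ae_eq_Icc
  have hmem : ∀ᵐ a ∂volume.restrict (Icc (0 : ℝ) 1), a ∈ Ioc (0 : ℝ) 1 := by
    rw [← hμ]; exact ae_restrict_mem measurableSet_Ioc
  rw [hμ] at hmeas
  have hπm := hπ.2.1.aestronglyMeasurable
  have hHnn : ∀ a ∈ Icc (0 : ℝ) 1, 0 ≤ H a := fun a ha =>
    ge_of_tendsto (hlim a ha) (hnn.mono fun k hk => hk a ha)
  have hHle : ∀ a ∈ Ioc (0 : ℝ) 1, H a ≤ 1 := fun a ha =>
    le_of_tendsto (hlim a (Ioc_subset_Icc_self ha)) (hle.mono fun k hk => hk a ha)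
  have hkm : ∀ᶠ k in atTop, AEStronglyMeasurable (fun a => h k a * π a)
      (volume.restrict (Icc (0 : ℝ) 1)) :=
    hmeas.mono fun k hk => hk.aestronglyMeasurable.mul hπm
  have hkb : ∀ᶠ k in atTop, ∀ᵐ a ∂volume.restrict (Icc (0 : ℝ) 1), ‖h k a * π a‖ ≤ π a := by
    filter_upwards [hnn, hle] with k h1 h2
    filter_upwards [hmem] with a ha
    have ha' := Ioc_subset_Icc_self ha
    rw [Real.norm_of_nonneg (mul_nonneg (h1 a ha') (hπ.1 a ha'))]
    exact mul_le_of_le_one_left (hπ.1 a ha') (h2 a ha)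
  have hkint : ∀ᶠ k in atTop, IntegrableOn (fun a => h k a * π a) (Icc 0 1) := by
    filter_upwards [hkm, hkb] with k h1 h2 using hπ.2.1.mono' h1 h2
  have hptw : ∀ᵐ a ∂volume.restrict (Icc (0 : ℝ) 1),
      Tendsto (fun k => h k a * π a) atTop (𝓝 (H a * π a)) := by
    filter_upwards [hmem] with a ha using (hlim a (Ioc_subset_Icc_self ha)).mul_const _
  have hHm : AEStronglyMeasurable (fun a => H a * π a) (volume.restrict (Icc (0 : ℝ) 1)) := by
    obtain ⟨N, hN⟩ := eventually_atTop.1 hkm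
    refine aestronglyMeasurable_of_tendsto_ae (u := atTop) (f := fun k a => h (k + N) a * π a)
      (fun k => hN _ (Nat.le_add_left N k)) ?_
    filter_upwards [hptw] with a ha using (tendsto_add_atTop_iff_nat N).2 ha
  have hHb : ∀ᵐ a ∂volume.restrict (Icc (0 : ℝ) 1), ‖H a * π a‖ ≤ π a := by
    filter_upwards [hmem] with a ha
    have ha' := Ioc_subset_Icc_self ha
    rw [Real.norm_of_nonneg (mul_nonneg (hHnn a ha') (hπ.1 a ha'))]
    exact mul_le_of_le_one_left (hπ.1 a ha') (hHle a ha)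
  have hHint : IntegrableOn (fun a => H a * π a) (Icc 0 1) := hπ.2.1.mono' hHm hHb
  set I := ∫ t in Icc (0 : ℝ) 1, H t * π t with hI
  have hI0 : 0 < I := integral_reweight_pos hπ hHpos hHint
  have hIk : Tendsto (fun k => ∫ t in Icc (0 : ℝ) 1, h k t * π t) atTop (𝓝 I) :=
    tendsto_integral_filter_of_dominated_convergence π hkm hkb hπ.2.1 hptw
  have hIpos := hIk.eventually_const_lt (half_lt_self hI0)
  have hunit : ∀ᶠ k in atTop, IsUnitDensity (p k) := by
    filter_upwards [hp, hIpos, hkint, hnn] with k h1 h2 h3 h4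
    have h2' := (half_pos hI0).trans h2
    rw [funext h1]
    refine ⟨fun a ha => div_nonneg (mul_nonneg (h4 a ha) (hπ.1 a ha)) h2'.le,
      h3.div_const _, ?_⟩
    rw [integral_div, div_self h2'.ne']
  have hunit' : IsUnitDensity p' := by
    rw [funext hp']
    refine ⟨fun a ha => div_nonneg (mul_nonneg (hHnn a ha) (hπ.1 a ha)) hI0.le,
      hHint.div_const _, ?_⟩
    rw [integral_div, div_self hI0.ne']
  have hconv : ∀ a ∈ Icc (0 : ℝ) 1, Tendsto (fun k => p k a) atTop (𝓝 (p' a)) := by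
    intro a ha
    rw [hp' a]
    refine (((hlim a ha).mul_const (π a)).div hIk hI0.ne').congr' ?_
    filter_upwards [hp] with k hk using (hk a).symm
  refine ⟨hunit, hunit', hconv, ?_⟩
  suffices hsuff : Tendsto (fun k => ∫ a in Icc (0 : ℝ) 1, |p k a - p' a|) atTop
      (𝓝 (∫ _ in Icc (0 : ℝ) 1, (0 : ℝ))) by simpa using hsuff
  -- Once the normalising integrals exceed `I / 2`, `p k` is at most `2π / I` and `p'` at most `π /
  -- I`.
  refine tendsto_integral_filter_of_dominated_convergence (fun a => 3 / I * π a) ?_ ?_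
    (hπ.2.1.const_mul _) ?_
  · filter_upwards [hunit] with k hk
    exact (hk.2.1.sub hunit'.2.1).abs.aestronglyMeasurable
  · filter_upwards [hp, hIpos, hkb] with k h1 h2 h3
    filter_upwards [h3, hHb, hmem] with a h4 h5 ha
    have hπa := hπ.1 a (Ioc_subset_Icc_self ha)
    have h2' := (half_pos hI0).trans h2
    rw [Real.norm_eq_abs, abs_abs]
    refine (abs_sub _ _).trans ?_
    rw [h1, hp', abs_div, abs_div, abs_of_pos h2', abs_of_pos hI0]
    have h6 := div_le_div₀ hπa h4 (half_pos hI0) h2.le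
    have h7 := div_le_div_of_nonneg_right h5 hI0.le
    rw [Real.norm_eq_abs] at h6 h7
    calc _ ≤ π a / (I / 2) + π a / I := add_le_add h6 h7
      _ = 3 / I * π a := by field_simp; ring
  · filter_upwards [hmem] with a ha
    simpa using ((hconv a (Ioc_subset_Icc_self ha)).sub_const (p' a)).abs

/-- Densities converging in `L¹` to a density do not concentrate at a point. -/
lemma DensitiesConverge.not_concentratesAtOne (hc : DensitiesConverge p p') :
    ¬ ConcentratesAtOne p := by
  intro hone
  obtain ⟨hunit, hunit', -, hL1⟩ := hc
  -- Under concentration the limit would put mass one on every `[1 - ε, 1]`; shrinking these to the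
  -- null set `{1}` gives a contradiction.
  have hval : ∀ ε ∈ Ioo (0 : ℝ) 1, ∫ a in Icc (1 - ε) 1, p' a = 1 := by
    intro ε hε
    have hsub : Icc (1 - ε) 1 ⊆ Icc (0 : ℝ) 1 := Icc_subset_Icc_left (by linarith [hε.2])
    have hdiff : Tendsto (fun k => (∫ a in Icc (1 - ε) 1, p k a) - ∫ a in Icc (1 - ε) 1, p' a)
        atTop (𝓝 0) := by
      refine squeeze_zero_norm' ?_ hL1
      filter_upwards [hunit] with k hk
      rw [← integral_sub (hk.2.1.mono_set hsub) (hunit'.2.1.mono_set hsub)]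
      refine (norm_integral_le_integral_norm _).trans ?_
      exact setIntegral_mono_set (hk.2.1.sub hunit'.2.1).abs (ae_of_all _ fun _ => abs_nonneg _)
        hsub.eventuallyLE
    have h1 := (hone ε hε).sub_const (∫ a in Icc (1 - ε) 1, p' a)
    linarith [tendsto_nhds_unique h1 hdiff]
  have hsub : ∀ j : ℕ, (1 : ℝ) / (j + 2) ∈ Ioo (0 : ℝ) 1 := fun j => by
    have : (0 : ℝ) ≤ j := j.cast_nonneg
    refine ⟨by positivity, ?_⟩
    rw [div_lt_one (by positivity)]
    linarith
  have hanti : Antitone fun j : ℕ => Icc (1 - 1 / ((j : ℝ) + 2)) 1 := by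
    intro i j hij
    refine Icc_subset_Icc_left (sub_le_sub_left (one_div_le_one_div_of_le (by positivity) ?_) _)
    have : (i : ℝ) ≤ j := Nat.cast_le.2 hij
    linarith
  have hinter : ⋂ j : ℕ, Icc (1 - 1 / ((j : ℝ) + 2)) 1 = {1} := by
    refine Subset.antisymm (fun a ha => ?_) (fun a ha => ?_)
    · rw [mem_iInter] at ha
      have h1 : Tendsto (fun j : ℕ => 1 - 1 / ((j : ℝ) + 2)) atTop (𝓝 1) := by
        have h2 := ((tendsto_one_div_add_atTop_nhds_zero_nat (𝕜 := ℝ)).comp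
          (tendsto_add_atTop_nat 1)).const_sub 1
        rw [sub_zero] at h2
        refine h2.congr fun j => ?_
        simp only [Function.comp_apply, Nat.cast_add, Nat.cast_one]
        ring
      exact le_antisymm (ha 0).2 (le_of_tendsto' h1 fun j => (ha j).1)
    · rw [mem_singleton_iff.1 ha]
      exact mem_iInter.2 fun j => ⟨by linarith [(hsub j).1], le_rfl⟩
  have ht := tendsto_setIntegral_of_antitone (fun j => measurableSet_Icc) hanti
    ⟨0, hunit'.2.1.mono_set (Icc_subset_Icc_left (sub_nonneg.2 (hsub 0).2.le))⟩
  rw [hinter] at ht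
  have h1 : ∫ a in ({1} : Set ℝ), p' a = 0 := by simp
  rw [h1] at ht
  have h2 : Tendsto (fun j : ℕ => ∫ a in Icc (1 - 1 / ((j : ℝ) + 2)) 1, p' a) atTop (𝓝 1) := by
    simp_rw [fun j : ℕ => hval _ (hsub j)]
    exact tendsto_const_nhds
  exact zero_ne_one (tendsto_nhds_unique ht h2)

end Reweighting

/-! ### The marginal posterior as a reweighted prior. -/

section Posterior

variable {ν : Measure ℝ} {q b π₀ π : ℝ → ℝ} {Θ : Set ℝ} {n m : ℕ} {D : Fin n → ℝ}
  {D₀ : Fin m → ℝ} {x : ℝ}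

lemma likelihood_pos (hD : ∀ i, 0 < q (D i)) (θ : ℝ) : 0 < likelihood q b D θ :=
  Finset.prod_pos fun i _ => mul_pos (hD i) (Real.exp_pos _)

/-- The likelihood relative to its maximum. -/
lemma likelihood_eq (hx : deriv b x = sampleMean D) (θ : ℝ) :
    likelihood q b D θ = likelihood q b D x * Real.exp (-(n * bregman b x θ)) := by
  have hsum : (n : ℝ) * sampleMean D = ∑ i, D i := by
    -- For an empty sample the mean is `0 / 0 = 0`, and the identity persists.
    rcases eq_or_ne n 0 with rfl | hn
    · simp
    · rw [sampleMean, mul_div_cancel₀ _ (Nat.cast_ne_zero.2 hn)]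
  have hform : ∀ t, likelihood q b D t =
      (∏ i, q (D i)) * Real.exp ((n : ℝ) * sampleMean D * t - n * b t) := by
    intro t
    simp only [likelihood, density, Finset.prod_mul_distrib, ← Real.exp_sum]
    rw [Finset.sum_sub_distrib, ← Finset.sum_mul, hsum]
    simp
  rw [hform θ, hform x, mul_assoc _ (Real.exp _), ← Real.exp_add, ← hx, bregman]
  congr 2
  ring

lemma powerPriorKernel_eq (hD₀ : ∀ i, 0 < q (D₀ i)) (hx : deriv b x = sampleMean D₀) (a θ : ℝ) :
    powerPriorKernel q b π₀ D₀ a θ =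
      likelihood q b D₀ x ^ a * (Real.exp (-(a * m * bregman b x θ)) * π₀ θ) := by
  rw [powerPriorKernel, likelihood_eq hx, Real.mul_rpow (likelihood_pos hD₀ x).le
    (Real.exp_pos _).le, ← Real.exp_mul, mul_assoc]
  congr 3
  ring_nf

lemma normConst_eq (hD₀ : ∀ i, 0 < q (D₀ i)) (hx : deriv b x = sampleMean D₀) (a : ℝ) :
    normConst q b Θ π₀ D₀ a = likelihood q b D₀ x ^ a * laplaceIntegral b Θ π₀ x (a * m) := by
  simp_rw [normConst, powerPriorKernel_eq hD₀ hx, integral_const_mul]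
  rfl

/-- The weight by which the data reweight the prior of the discounting parameter. -/
noncomputable def weight (b : ℝ → ℝ) (Θ : Set ℝ) (π₀ : ℝ → ℝ) (x n m a : ℝ) : ℝ :=
  laplaceIntegral b Θ π₀ x (n + a * m) / laplaceIntegral b Θ π₀ x (a * m)

/-- The common mode lets the two exponents add to the rate `n + a m`, while the maximum of the
historical likelihood cancels against the one in `c(a)`. -/
lemma posteriorKernel_eq (hD₀ : ∀ i, 0 < q (D₀ i))
    (hx : deriv b x = sampleMean D) (hx₀ : deriv b x = sampleMean D₀) (a : ℝ) :
    posteriorKernel q b Θ π₀ π D D₀ a =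
      likelihood q b D x * (weight b Θ π₀ x n m a * π a) := by
  have hL := (Real.rpow_pos_of_pos (likelihood_pos (b := b) hD₀ x) a).ne'
  have h1 : ∀ θ, likelihood q b D θ * normalizedPowerPrior q b Θ π₀ π D₀ θ a =
      likelihood q b D x * π a / laplaceIntegral b Θ π₀ x (a * m) *
        (Real.exp (-((n + a * m) * bregman b x θ)) * π₀ θ) := by
    intro θ
    have h2 : Real.exp (-((n + a * m) * bregman b x θ)) =
        Real.exp (-(n * bregman b x θ)) * Real.exp (-(a * m * bregman b x θ)) := by
      rw [← Real.exp_add]; ring_nf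
    rw [normalizedPowerPrior, powerPriorKernel_eq hD₀ hx₀, normConst_eq hD₀ hx₀,
      likelihood_eq hx, mul_div_mul_left _ _ hL, h2]
    ring
  simp_rw [posteriorKernel, h1, integral_const_mul]
  change _ * laplaceIntegral b Θ π₀ x (n + a * m) = _
  rw [weight]
  ring

lemma marginalPosterior_eq (hD : ∀ i, 0 < q (D i)) (hD₀ : ∀ i, 0 < q (D₀ i))
    (hx : deriv b x = sampleMean D) (hx₀ : deriv b x = sampleMean D₀) (a : ℝ) :
    marginalPosterior q b Θ π₀ π D D₀ a =
      weight b Θ π₀ x n m a * π a / ∫ t in Icc (0 : ℝ) 1, weight b Θ π₀ x n m t * π t := by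
  simp_rw [marginalPosterior, posteriorKernel_eq hD₀ hx hx₀, integral_const_mul]
  exact mul_div_mul_left _ _ (likelihood_pos hD x).ne'

lemma integrableOn_of_powerPriorProper (hD₀ : ∀ i, 0 < q (D₀ i))
    (hx : deriv b x = sampleMean D₀) (hprop : PowerPriorProper q b Θ π₀ D₀) {a : ℝ}
    (ha : a ∈ Ioc (0 : ℝ) 1) :
    IntegrableOn (fun θ => Real.exp (-(a * m * bregman b x θ)) * π₀ θ) Θ := by
  have h := hprop a ha
  have hL := (Real.rpow_pos_of_pos (likelihood_pos (b := b) hD₀ x) a).ne'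
  have h1 := h.const_mul (likelihood q b D₀ x ^ a)⁻¹
  refine h1.congr (ae_of_all _ fun θ => ?_)
  simp only [powerPriorKernel_eq hD₀ hx, inv_mul_cancel_left₀ hL]

/-- Measurability of `π₀` is recovered from the kernel by multiplying back the continuous factor
`exp(t B)`. -/
lemma aestronglyMeasurable_of_integrable_kernel (ho : IsOpen Θ) (hb : AnalyticOnNhd ℝ b Θ) {t : ℝ}
    (h : IntegrableOn (fun θ => Real.exp (-(t * bregman b x θ)) * π₀ θ) Θ) :
    AEStronglyMeasurable π₀ (volume.restrict Θ) := by
  have hc := continuousOn_bregman hb x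
  have h1 : AEStronglyMeasurable (fun θ => Real.exp (t * bregman b x θ)) (volume.restrict Θ) :=
    ContinuousOn.aestronglyMeasurable (by fun_prop) ho.measurableSet
  refine (h1.mul h.aestronglyMeasurable).congr (ae_of_all _ fun θ => ?_)
  simp only [Pi.mul_apply]
  rw [← mul_assoc, ← Real.exp_add, add_neg_cancel, Real.exp_zero, one_mul]

lemma integrableOn_kernel_mono (ho : IsOpen Θ) (hc : Θ.OrdConnected) (hb : AnalyticOnNhd ℝ b Θ)
    (hpos : ∀ θ ∈ Θ, 0 < deriv (deriv b) θ) (hx : x ∈ Θ) {s t : ℝ} (hst : s ≤ t)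
    (h : IntegrableOn (fun θ => Real.exp (-(s * bregman b x θ)) * π₀ θ) Θ) :
    IntegrableOn (fun θ => Real.exp (-(t * bregman b x θ)) * π₀ θ) Θ := by
  refine Integrable.mono h (aestronglyMeasurable_kernel ho hb
    (aestronglyMeasurable_of_integrable_kernel ho hb h) x t) ?_
  filter_upwards [ae_restrict_mem ho.measurableSet] with θ hθ
  rw [norm_mul, norm_mul]
  refine mul_le_mul_of_nonneg_right ?_ (norm_nonneg _)
  rw [Real.norm_eq_abs, Real.abs_exp, Real.norm_eq_abs, Real.abs_exp, Real.exp_le_exp]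
  linarith [mul_le_mul_of_nonneg_right hst (bregman_nonneg hc hb hpos hx hθ)]

lemma laplaceIntegral_nonneg (ho : IsOpen Θ) (hπ₀ : ∀ θ ∈ Θ, 0 ≤ π₀ θ) (s : ℝ) :
    0 ≤ laplaceIntegral b Θ π₀ x s :=
  setIntegral_nonneg ho.measurableSet fun θ hθ => mul_nonneg (Real.exp_pos _).le (hπ₀ θ hθ)

lemma laplaceIntegral_antitone (ho : IsOpen Θ) (hc : Θ.OrdConnected) (hb : AnalyticOnNhd ℝ b Θ)
    (hpos : ∀ θ ∈ Θ, 0 < deriv (deriv b) θ) (hπ₀ : ∀ θ ∈ Θ, 0 ≤ π₀ θ) (hx : x ∈ Θ) {s t : ℝ}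
    (hst : s ≤ t) (h : IntegrableOn (fun θ => Real.exp (-(s * bregman b x θ)) * π₀ θ) Θ) :
    laplaceIntegral b Θ π₀ x t ≤ laplaceIntegral b Θ π₀ x s := by
  refine setIntegral_mono_on (integrableOn_kernel_mono ho hc hb hpos hx hst h) h
    ho.measurableSet fun θ hθ => mul_le_mul_of_nonneg_right (Real.exp_le_exp.2 ?_) (hπ₀ θ hθ)
  linarith [mul_le_mul_of_nonneg_right hst (bregman_nonneg hc hb hpos hx hθ)]

lemma weight_nonneg (ho : IsOpen Θ) (hπ₀ : ∀ θ ∈ Θ, 0 ≤ π₀ θ) (n m a : ℝ) :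
    0 ≤ weight b Θ π₀ x n m a :=
  div_nonneg (laplaceIntegral_nonneg ho hπ₀ _) (laplaceIntegral_nonneg ho hπ₀ _)

lemma weight_le_one (ho : IsOpen Θ) (hc : Θ.OrdConnected) (hb : AnalyticOnNhd ℝ b Θ)
    (hpos : ∀ θ ∈ Θ, 0 < deriv (deriv b) θ) (hπ₀ : ∀ θ ∈ Θ, 0 ≤ π₀ θ) (hx : x ∈ Θ)
    {n m a : ℝ} (hn : 0 ≤ n)
    (h : IntegrableOn (fun θ => Real.exp (-(a * m * bregman b x θ)) * π₀ θ) Θ) :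
    weight b Θ π₀ x n m a ≤ 1 :=
  div_le_one_of_le₀ (laplaceIntegral_antitone ho hc hb hpos hπ₀ hx (by linarith) h)
    (laplaceIntegral_nonneg ho hπ₀ _)

/-- Numerator and denominator are each antitone in `a`, which settles measurability without joint
measurability arguments. -/
lemma aemeasurable_weight (ho : IsOpen Θ) (hc : Θ.OrdConnected) (hb : AnalyticOnNhd ℝ b Θ)
    (hpos : ∀ θ ∈ Θ, 0 < deriv (deriv b) θ) (hπ₀ : ∀ θ ∈ Θ, 0 ≤ π₀ θ) (hx : x ∈ Θ)
    {n m : ℝ} (hn : 0 ≤ n) (hm : 0 ≤ m)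
    (h : ∀ a ∈ Ioc (0 : ℝ) 1,
      IntegrableOn (fun θ => Real.exp (-(a * m * bregman b x θ)) * π₀ θ) Θ) :
    AEMeasurable (weight b Θ π₀ x n m) (volume.restrict (Ioc 0 1)) := by
  refine AEMeasurable.div (aemeasurable_restrict_of_antitoneOn measurableSet_Ioc ?_)
    (aemeasurable_restrict_of_antitoneOn measurableSet_Ioc ?_)
  · intro a ha a' _ haa'
    exact laplaceIntegral_antitone ho hc hb hpos hπ₀ hx
      (add_le_add_right (mul_le_mul_of_nonneg_right haa' hm) n)
      (integrableOn_kernel_mono ho hc hb hpos hx (by linarith) (h a ha))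
  · intro a ha a' _ haa'
    exact laplaceIntegral_antitone ho hc hb hpos hπ₀ hx
      (mul_le_mul_of_nonneg_right haa' hm) (h a ha)

/-- The weights converge, by Laplace's approximation of numerator and denominator. -/
lemma tendsto_weight (ho : IsOpen Θ) (hc : Θ.OrdConnected) (hb : AnalyticOnNhd ℝ b Θ)
    (hpos : ∀ θ ∈ Θ, 0 < deriv (deriv b) θ) {x₀ : ℝ} (hx₀ : x₀ ∈ Θ) (hπ₀_pos : 0 < π₀ x₀)
    (hπ₀_cont : ContinuousAt π₀ x₀) {x n m : ℕ → ℝ} {r : ℝ} (hr : 0 < r)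
    (hx : Tendsto x atTop (𝓝 x₀)) (hn : Tendsto n atTop atTop) (hm : ∀ k, m k / n k = r)
    (hint : ∀ᶠ k in atTop, ∃ t, 0 ≤ t ∧
      IntegrableOn (fun θ => Real.exp (-(t * bregman b (x k) θ)) * π₀ θ) Θ)
    (hw : AEStronglyMeasurable π₀ (volume.restrict Θ)) {a : ℝ} (ha : 0 ≤ a) :
    Tendsto (fun k => weight b Θ π₀ (x k) (n k) (m k) a) atTop
      (𝓝 √(r * a / (r * a + 1))) := by
  have hlap : ∀ s : ℕ → ℝ, Tendsto s atTop atTop →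
      Tendsto (fun k => √(s k) * laplaceIntegral b Θ π₀ (x k) (s k)) atTop
        (𝓝 (π₀ x₀ * √(2 * Real.pi / deriv (deriv b) x₀))) := fun s hs =>
    tendsto_laplaceIntegral ho hc hb hpos hx₀ hπ₀_cont hx hs hint hw
  -- At `a = 0` the denominator is the constant `∫ π₀`, while the numerator decays like `1 / √n`.
  -- For improper `π₀` that integral is `0` by convention, and so is the quotient.
  rcases ha.eq_or_lt with rfl | ha
  · have h1 : Tendsto (fun k => (√(n k))⁻¹) atTop (𝓝 0) :=
      tendsto_inv_atTop_zero.comp (Real.tendsto_sqrt_atTop.comp hn)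
    have h2 := (h1.mul (hlap n hn)).div_const (∫ θ in Θ, π₀ θ)
    rw [zero_mul, zero_div] at h2
    rw [mul_zero, zero_div, Real.sqrt_zero]
    refine h2.congr' ?_
    filter_upwards [hn.eventually_gt_atTop 0] with k hk
    rw [inv_mul_cancel_left₀ (Real.sqrt_pos.2 hk).ne', weight]
    simp [laplaceIntegral]
  · have hmk : ∀ᶠ k in atTop, m k = r * n k := by
      filter_upwards [hn.eventually_gt_atTop 0] with k hk
      exact (div_eq_iff hk.ne').1 (hm k)
    have hs1 : Tendsto (fun k => a * m k) atTop atTop := by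
      refine (hn.const_mul_atTop (mul_pos ha hr)).congr' ?_
      filter_upwards [hmk] with k hk
      rw [hk]; ring
    have hs2 : Tendsto (fun k => n k + a * m k) atTop atTop := hn.atTop_add_atTop hs1
    have hne : π₀ x₀ * √(2 * Real.pi / deriv (deriv b) x₀) ≠ 0 := by
      have := hpos x₀ hx₀
      positivity
    -- The two Laplace limits are the same nonzero constant, so only the ratio of the square roots
    -- of the rates survives.
    have h1 := ((hlap _ hs2).div (hlap _ hs1) hne).const_mul √(r * a / (r * a + 1))
    rw [div_self hne, mul_one] at h1
    refine h1.congr' ?_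
    filter_upwards [hn.eventually_gt_atTop 0, hmk] with k hk hmk
    have e1 : 0 < a * m k := by rw [hmk]; positivity
    have e2 : 0 < n k + a * m k := by positivity
    have e3 : r * a / (r * a + 1) = a * m k / (n k + a * m k) := by
      rw [hmk]; field_simp; ring
    have e4 := (Real.sqrt_pos.2 e1).ne'
    have e5 := (Real.sqrt_pos.2 e2).ne'
    rw [e3, Real.sqrt_div e1.le, weight, Pi.div_apply, mul_div_mul_comm, ← mul_assoc, div_mul_div_cancel₀ e5,
      div_self e4, one_mul]

/-- Convergence of the marginal posterior along data sets with equal means whose maximum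
likelihood estimates converge. -/
theorem densitiesConverge_marginalPosterior (ho : IsOpen Θ) (hc : Θ.OrdConnected)
    (hb : AnalyticOnNhd ℝ b Θ) (hpos : ∀ θ ∈ Θ, 0 < deriv (deriv b) θ)
    (hπ₀ : ∀ θ ∈ Θ, 0 ≤ π₀ θ) {x₀ : ℝ} (hx₀ : x₀ ∈ Θ) (hπ₀_pos : 0 < π₀ x₀)
    (hπ₀_cont : ContinuousAt π₀ x₀) (hπ : IsUnitDensity π) {r : ℝ} (hr : 0 < r)
    {n m : ℕ → ℕ} {D : (k : ℕ) → Fin (n k) → ℝ} {D₀ : (k : ℕ) → Fin (m k) → ℝ} {x : ℕ → ℝ}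
    (hn : Tendsto n atTop atTop) (hm : ∀ k, (m k : ℝ) / (n k : ℝ) = r)
    (hD : ∀ k i, 0 < q (D k i)) (hD₀ : ∀ k i, 0 < q (D₀ k i))
    (hmean : ∀ k, sampleMean (D k) = sampleMean (D₀ k))
    (hmle : ∀ᶠ k in atTop, x k ∈ Θ ∧ deriv b (x k) = sampleMean (D k))
    (hx : Tendsto x atTop (𝓝 x₀))
    (hprop : ∀ᶠ k in atTop, PowerPriorProper q b Θ π₀ (D₀ k)) :
    DensitiesConverge (fun k => marginalPosterior q b Θ π₀ π (D k) (D₀ k))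
      (limitDensity r π) := by
  have hint : ∀ᶠ k in atTop, ∀ a ∈ Ioc (0 : ℝ) 1,
      IntegrableOn (fun θ => Real.exp (-(a * m k * bregman b (x k) θ)) * π₀ θ) Θ := by
    filter_upwards [hmle, hprop] with k h1 h2 a ha
    exact integrableOn_of_powerPriorProper (hD₀ k) (h1.2.trans (hmean k)) h2 ha
  obtain ⟨k₁, hk₁⟩ := hint.exists
  have hw := aestronglyMeasurable_of_integrable_kernel ho hb (hk₁ 1 ⟨one_pos, le_rfl⟩)
  refine densitiesConverge_of_weights (h := fun k => weight b Θ π₀ (x k) (n k) (m k))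
    (H := fun a => √(r * a / (r * a + 1))) hπ ?_ ?_ ?_ ?_ ?_ ?_ fun a => rfl
  · intro a ha
    have := ha.1
    positivity
  · intro a ha
    exact tendsto_weight ho hc hb hpos hx₀ hπ₀_pos hπ₀_cont hr hx
      (tendsto_natCast_atTop_atTop.comp hn) hm
      (hint.mono fun k hk => ⟨_, by positivity, hk 1 ⟨one_pos, le_rfl⟩⟩) hw ha.1
  · exact Eventually.of_forall fun k a _ => weight_nonneg ho hπ₀ _ _ _
  · filter_upwards [hint, hmle] with k h1 h2 a ha
    exact weight_le_one ho hc hb hpos hπ₀ h2.1 (Nat.cast_nonneg _) (h1 a ha)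
  · filter_upwards [hint, hmle] with k h1 h2
    exact aemeasurable_weight ho hc hb hpos hπ₀ h2.1 (Nat.cast_nonneg _) (Nat.cast_nonneg _) h1
  · filter_upwards [hmle] with k h1 a
    exact marginalPosterior_eq (hD k) (hD₀ k) h1.2 (h1.2.trans (hmean k)) a

end Posterior

end NPP

/-! ### Random samples and the final theorem. -/

namespace NPP

/-- A moment estimator: near `x₀` the equation `b' x = y` is solved continuously. -/
lemma exists_tendsto_deriv_eq {b : ℝ → ℝ} {x₀ : ℝ} (hb : AnalyticAt ℝ b x₀)
    (hne : deriv (deriv b) x₀ ≠ 0) {y : ℕ → ℝ} (hy : Tendsto y atTop (𝓝 (deriv b x₀))) :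
    ∃ x : ℕ → ℝ, Tendsto x atTop (𝓝 x₀) ∧ ∀ᶠ k in atTop, deriv b (x k) = y k := by
  have hs := hb.deriv.hasStrictDerivAt
  refine ⟨fun k => hs.localInverse _ _ _ hne (y k), ?_, hy.eventually (hs.eventually_right_inverse hne)⟩
  exact (HasStrictFDerivAt.localInverse_tendsto _).comp hy

namespace IsExpFamily

variable {ν : Measure ℝ} {q b : ℝ → ℝ} {Θ : Set ℝ} {Ω : Type*} [MeasurableSpace Ω] {P : Measure Ω}

lemma measurable_density (h : IsExpFamily ν q b Θ) (θ : ℝ) : Measurable (density q b θ) := by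
  have := h.measurable_q
  unfold density
  fun_prop

/-- The density vanishes wherever `q` does, so the law of `Y` gives that set no mass. -/
lemma ae_q_pos (h : IsExpFamily ν q b Θ) {θ : ℝ} {Y : Ω → ℝ} (hY : AEMeasurable Y P)
    (hlaw : P.map Y = ν.withDensity fun y => ENNReal.ofReal (density q b θ y)) :
    ∀ᵐ ω ∂P, 0 < q (Y ω) := by
  refine ae_of_ae_map hY (p := fun y => 0 < q y) ?_
  rw [hlaw, ae_withDensity_iff (h.measurable_density θ).ennreal_ofReal]
  refine ae_of_all _ fun y hy => (h.q_nonneg y).lt_of_ne fun h0 => hy ?_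
  rw [density, ← h0, zero_mul, ENNReal.ofReal_zero]

/-- The sample mean of an i.i.d. sample converges to the mean of the family. -/
lemma ae_tendsto_sampleMean (h : IsExpFamily ν q b Θ) {θ : ℝ} (hθ : θ ∈ Θ) {Y : ℕ → Ω → ℝ}
    (hY : ∀ i, AEMeasurable (Y i) P) (hindep : Pairwise (Function.onFun (fun f g => f ⟂ᵢ[P] g) Y))
    (hlaw : ∀ i, P.map (Y i) = ν.withDensity fun y => ENNReal.ofReal (density q b θ y)) :
    ∀ᵐ ω ∂P, Tendsto (fun n : ℕ => sampleMean fun i : Fin n => Y i ω) atTop (𝓝 (deriv b θ)) := by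
  have hint : Integrable (Y 0) P := by
    have h1 := h.integrable_id hθ
    rw [← hlaw 0] at h1
    exact h1.comp_aemeasurable (hY 0)
  have hmean : ∫ ω, Y 0 ω ∂P = deriv b θ := by
    rw [← h.integral_id hθ, ← hlaw 0, integral_map (hY 0) (by fun_prop)]
  have hslln := strong_law_ae_real Y hint hindep
    fun i => ⟨hY i, hY 0, (hlaw i).trans (hlaw 0).symm⟩
  rw [hmean] at hslln
  filter_upwards [hslln] with ω hω
  refine hω.congr fun n => ?_
  rw [sampleMean, Fin.sum_univ_eq_sum_range (fun i => Y i ω)]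

end IsExpFamily

end NPP

theorem corollary2p1
    -- the exponential family, with `b'' > 0` (strictly concave log-likelihood)
    (ν : Measure ℝ) (q b : ℝ → ℝ) (Θ : Set ℝ) (hfam : NPP.IsExpFamily ν q b Θ)
    (hb : ∀ θ ∈ Θ, 0 < deriv (deriv b) θ)
    -- the initial prior on `θ` (possibly improper), positive and continuous at `θ₀`
    (π₀ : ℝ → ℝ) (hπ₀ : ∀ θ ∈ Θ, 0 ≤ π₀ θ)
    (θ₀ : ℝ) (hθ₀ : θ₀ ∈ Θ) (hπ₀_pos : 0 < π₀ θ₀) (hπ₀_cont : ContinuousAt π₀ θ₀)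
    -- the prior on `a₀`
    (π : ℝ → ℝ) (hπ : NPP.IsUnitDensity π)
    -- the ratio of the sample sizes
    (r : ℝ) (hr : 0 < r)
    -- the probability space of the sampling statement
    {Ω : Type*} [MeasurableSpace Ω] (P : Measure Ω) [IsProbabilityMeasure P] :
    -- every sequence of data sets with equal means whose MLE converges to `θ₀`
    (∀ (n n₀ : ℕ → ℕ) (D : (k : ℕ) → Fin (n k) → ℝ) (D₀ : (k : ℕ) → Fin (n₀ k) → ℝ)
        (θhat : ℕ → ℝ),
      Tendsto n atTop atTop →
      (∀ k, (n₀ k : ℝ) / (n k : ℝ) = r) →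
      (∀ k i, 0 < q (D k i)) → (∀ k i, 0 < q (D₀ k i)) →
      (∀ k, NPP.sampleMean (D k) = NPP.sampleMean (D₀ k)) →
      (∀ᶠ k in atTop, θhat k ∈ Θ ∧ deriv b (θhat k) = NPP.sampleMean (D k)) →
      Tendsto θhat atTop (𝓝 θ₀) →
      (∀ᶠ k in atTop, NPP.PowerPriorProper q b Θ π₀ (D₀ k)) →
      NPP.DensitiesConverge (fun k => NPP.marginalPosterior q b Θ π₀ π (D k) (D₀ k))
          (NPP.limitDensity r π) ∧
        ¬ NPP.ConcentratesAtOne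
          (fun k => NPP.marginalPosterior q b Θ π₀ π (D k) (D₀ k))) ∧
    -- i.i.d. sampling from `p(· | θ₀)`: almost surely, along all sample sizes with equal means
    (∀ Y Y₀ : ℕ → Ω → ℝ,
      (∀ i, AEMeasurable (Y i) P) → (∀ i, AEMeasurable (Y₀ i) P) →
      iIndepFun (Sum.elim Y Y₀) P →
      (∀ i, P.map (Y i) = ν.withDensity (fun y => ENNReal.ofReal (NPP.density q b θ₀ y))) →
      (∀ i, P.map (Y₀ i) = ν.withDensity (fun y => ENNReal.ofReal (NPP.density q b θ₀ y))) →
      ∀ᵐ ω ∂P, ∀ n n₀ : ℕ → ℕ,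
        Tendsto n atTop atTop →
        (∀ k, (n₀ k : ℝ) / (n k : ℝ) = r) →
        (∀ k, NPP.sampleMean (fun i : Fin (n k) => Y i ω) =
          NPP.sampleMean (fun i : Fin (n₀ k) => Y₀ i ω)) →
        (∀ᶠ k in atTop, NPP.PowerPriorProper q b Θ π₀ (fun i : Fin (n₀ k) => Y₀ i ω)) →
        NPP.DensitiesConverge
            (fun k => NPP.marginalPosterior q b Θ π₀ π
              (fun i : Fin (n k) => Y i ω) (fun i : Fin (n₀ k) => Y₀ i ω))
            (NPP.limitDensity r π) ∧
          ¬ NPP.ConcentratesAtOne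
            (fun k => NPP.marginalPosterior q b Θ π₀ π
              (fun i : Fin (n k) => Y i ω) (fun i : Fin (n₀ k) => Y₀ i ω))) := by 
  have hb_an := hfam.analyticOnNhd
  have key : ∀ (n n₀ : ℕ → ℕ) (D : (k : ℕ) → Fin (n k) → ℝ) (D₀ : (k : ℕ) → Fin (n₀ k) → ℝ)
      (θhat : ℕ → ℝ), Tendsto n atTop atTop → (∀ k, (n₀ k : ℝ) / (n k : ℝ) = r) →
      (∀ k i, 0 < q (D k i)) → (∀ k i, 0 < q (D₀ k i)) →
      (∀ k, NPP.sampleMean (D k) = NPP.sampleMean (D₀ k)) →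
      (∀ᶠ k in atTop, θhat k ∈ Θ ∧ deriv b (θhat k) = NPP.sampleMean (D k)) →
      Tendsto θhat atTop (𝓝 θ₀) →
      (∀ᶠ k in atTop, NPP.PowerPriorProper q b Θ π₀ (D₀ k)) →
      NPP.DensitiesConverge (fun k => NPP.marginalPosterior q b Θ π₀ π (D k) (D₀ k))
          (NPP.limitDensity r π) ∧
        ¬ NPP.ConcentratesAtOne
          (fun k => NPP.marginalPosterior q b Θ π₀ π (D k) (D₀ k)) := by
    intro n n₀ D D₀ θhat hn hm hD hD₀ hmean hmle hθhat hprop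
    have h := NPP.densitiesConverge_marginalPosterior hfam.isOpen hfam.ordConnected hb_an hb hπ₀
      hθ₀ hπ₀_pos hπ₀_cont hπ hr hn hm hD hD₀ hmean hmle hθhat hprop
    exact ⟨h, h.not_concentratesAtOne⟩
  refine ⟨key, fun Y Y₀ hY hY₀ hindep hlaw hlaw₀ => ?_⟩
  have hpair : Pairwise (Function.onFun (fun f g => f ⟂ᵢ[P] g) Y) := fun i j hij =>
    hindep.indepFun (i := Sum.inl i) (j := Sum.inl j) (by simpa using hij)
  -- The exceptional null set is fixed before the sample sizes are chosen: convergence of the full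
  -- sequence of means passes to every `n → ∞`.
  filter_upwards [hfam.ae_tendsto_sampleMean hθ₀ hY hpair hlaw,
    ae_all_iff.2 fun i => hfam.ae_q_pos (hY i) (hlaw i),
    ae_all_iff.2 fun i => hfam.ae_q_pos (hY₀ i) (hlaw₀ i)] with ω hmeanω hq hq₀
  intro n n₀ hn hm hmean hprop
  -- The local inverse of `b'` at `θ₀`, applied to the sample means, yields the estimates; they lie
  -- in the open set `Θ` eventually.
  obtain ⟨θhat, hθhat, hmle⟩ := NPP.exists_tendsto_deriv_eq (hb_an θ₀ hθ₀) (hb θ₀ hθ₀).ne'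
    (hmeanω.comp hn)
  exact key n n₀ _ _ θhat hn hm (fun k i => hq i) (fun k i => hq₀ i) hmean
    ((hθhat.eventually_mem (hfam.isOpen.mem_nhds hθ₀)).and hmle) hθhat hprop
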